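/- Let $\mathcal H$ be a real Hilbert space and let $\Phi,\Phi_1,\dots,\Phi_n:\mathcal H\to\mathbb R\cup\{+\infty\}$ be convex, lower semicontinuous and proper, with $\Phi=\sum_{i=1}^n p_i\Phi_i$, where $p_i>0$ and $\sum_i p_i=1$. Assume $\inf\Phi_i>-\infty$ and $\operatorname{dom}\Phi\subset\operatorname{dom}\Phi_i\subset\overline{\operatorname{dom}\Phi}$ for all $i$. Let $\mathcal B_1,\dots,\mathcal B_m$ be nonempty sets (batches) with $\bigcup_j\mathcal B_j=\{1,\dots,n\}$ and let $\pi_1,\dots,\pi_m>0$ satisfy $p_i=\sum_{j:\,i\in\mathcal B_j}\pi_j|\mathcal B_j|^{-1}$ for all $i$. Put $\Phi_{\mathcal B}:=|\mathcal B|^{-1}\sum_{i\in\mathcal B}\Phi_i$ and assume the sum rule $\partial\Phi(x)=\sum_{j=1}^m\pi_j\,\partial\Phi_{\mathcal B_j}(x)$ for all $x\in\operatorname{dom}\partial\Phi$. For $x\in\operatorname{dom}\partial\Phi$ let $\partial\Phi(x)^\circ$ be the element of minimal norm of $\partial\Phi(x)$, and fix functions $\xi_1,\dots,\xi_m$ on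 $\operatorname{dom}\partial\Phi$ with $\xi_j(x)\in\partial\Phi_{\mathcal B_j}(x)$ and $\partial\Phi(x)^\circ=\sum_{j=1}^m\pi_j\xi_j(x)$ for all $x\in\operatorname{dom}\partial\Phi$. Set $$\Lambda(x):=\sum_{j=1}^m\pi_j\|\xi_j(x)-\partial\Phi(x)^\circ\|^2 .$$ Let $u_0\in\operatorname{dom}\partial\Phi$ and let $u:[0,\infty)\to\mathcal H$ be the strong solution of the gradient flow, i.e. $u$ is locally absolutely continuous, $u(0)=u_0$ and $\dot u(t)\in-\partial\Phi(u(t))$ for a.e. $t>0$. Let $(j_k)_{k\ge1}$ be independent random variables with $\mathbb P(j_k=j)=\pi_j$. For $\varepsilon>0$ put $t_k:=k\varepsilon$ and let $v_\varepsilon$ be the solution of the mini-batch descent flow, i.e. (for each realization of $(j_k)$) $v_\varepsilon:[0,\infty)\to\mathcal H$ is continuous, $v_\varepsilon(0)=u_0$, and for every $k\ge1$, $v_\varepsilon$ is locally absolutely continuous in $(t_{k-1},t_k)$ with $\dot v_\varepsilon(t)\in-\partial\Phi_{\mathcal B_{j_k}}(v_\varepsilon(t))$ for a.e. $t\in[t_{k-1},t_k)$.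 Then for every realization, every $\varepsilon>0$ and every $t\ge0$, $$\|v_\varepsilon(t)-u(t)\|\le\max_{1\le j\le m}\pi_j^{-1/2}\;t^{1/2}\Big(\int_0^t\Lambda(u(s))\,ds\Big)^{1/2}$$ and $$\|v_\varepsilon(t)\|\le\max_{1\le j\le m}\pi_j^{-1/2}\;t^{1/2}\Big(\int_0^t\Lambda(u(s))\,ds\Big)^{1/2}+t\,\|\partial\Phi(u_0)^\circ\|+\|u_0\|,$$ where the integral takes values in $[0,+\infty]$ (if $\Lambda\circ u$ is not measurable, it is the lower integral, i.e. the supremum of the integrals of the measurable functions $g$ with $0\le g\le\Lambda\circ u$). Consequently, if $\Lambda\circ u$ is locally integrable on $[0,\infty)$, then for every $T\ge0$ there is a constant $C$, independent of $\varepsilon$ and of the realization, such that $\|v_\varepsilon(t)\|\le C$ for all $t\in[0,T]$, and $v_\varepsilon\in L^2([0,T];\mathcal H)$ with $\|v_\varepsilon\|_{L^2([0,T];\mathcal H)}\le C$, for every $\varepsilon>0$. -/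

import Mathlib

open MeasureTheory Set

namespace MiniBatch

noncomputable section

/-- Effective domain of an extended-real-valued function. -/
def effDom {H : Type*} (Φ : H → EReal) : Set H := {x | Φ x ≠ ⊤}

/-- Convex, lower semicontinuous and proper functions with values in `ℝ ∪ {+∞}`
(in `EReal`, `0 * ⊤ = 0`). -/
structure IsPotential {H : Type*} [NormedAddCommGroup H] [InnerProductSpace ℝ H]
    (Φ : H → EReal) : Prop where
  ne_bot : ∀ x, Φ x ≠ ⊥
  proper : ∃ x, Φ x ≠ ⊤
  convex : ∀ x y : H, ∀ a b : ℝ, 0 ≤ a → 0 ≤ b → a + b = 1 →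
    Φ (a • x + b • y) ≤ (a : EReal) * Φ x + (b : EReal) * Φ y
  lsc : LowerSemicontinuous Φ

/-- The convex subdifferential of `Φ` at `x`. -/
def subdiff {H : Type*} [NormedAddCommGroup H] [InnerProductSpace ℝ H]
    (Φ : H → EReal) (x : H) : Set H :=
  {ξ | Φ x ≠ ⊤ ∧ ∀ y, Φ x + ((inner ℝ ξ (y - x) : ℝ) : EReal) ≤ Φ y}

/-- The domain of the subdifferential. -/
def domSubdiff {H : Type*} [NormedAddCommGroup H] [InnerProductSpace ℝ H]
    (Φ : H → EReal) : Set H := {x | (subdiff Φ x).Nonempty}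

open Classical in
/-- The element of minimal norm of the subdifferential. For a potential on a Hilbert space the
subdifferential is closed and convex, so on its domain this element exists and is unique; elsewhere
the value is `0`. -/
def minSubgrad {H : Type*} [NormedAddCommGroup H] [InnerProductSpace ℝ H]
    (Φ : H → EReal) (x : H) : H :=
  if h : ∃ ξ ∈ subdiff Φ x, ∀ η ∈ subdiff Φ x, ‖ξ‖ ≤ ‖η‖ then h.choose else 0

/-- The potential of a batch: the average of the potentials whose index lies in the batch. -/
def batchPot {H : Type*} {n : ℕ} (Φi : Fin n → H → EReal) (B : Finset (Fin n)) (x : H) : EReal :=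
  (((B.card : ℝ)⁻¹ : ℝ) : EReal) * ∑ i ∈ B, Φi i x

/-- The setting: `Φ = ∑ p i * Φi i` is a convex combination of potentials, the batches `B j`
with probabilities `π j` are compatible with the weights `p i`, and the sum rule for
subdifferentials holds. -/
structure IsSplitting {H : Type*} [NormedAddCommGroup H] [InnerProductSpace ℝ H] {n m : ℕ}
    (Φ : H → EReal) (Φi : Fin n → H → EReal) (p : Fin n → ℝ)
    (B : Fin m → Finset (Fin n)) (π : Fin m → ℝ) : Prop where
  potential : IsPotential Φ
  potential_i : ∀ i, IsPotential (Φi i)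
  p_pos : ∀ i, 0 < p i
  p_sum : ∑ i, p i = 1
  average : ∀ x, Φ x = ∑ i, (p i : EReal) * Φi i x
  bddBelow : ∀ i, ⊥ < ⨅ x, Φi i x
  dom_subset : ∀ i, effDom Φ ⊆ effDom (Φi i)
  dom_subset_closure : ∀ i, effDom (Φi i) ⊆ closure (effDom Φ)
  batch_nonempty : ∀ j, (B j).Nonempty
  batch_cover : ∀ i, ∃ j, i ∈ B j
  π_pos : ∀ j, 0 < π j
  p_eq : ∀ i, p i = ∑ j with i ∈ B j, π j * ((B j).card : ℝ)⁻¹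
  sum_rule : ∀ x ∈ domSubdiff Φ, subdiff Φ x =
    {η | ∃ ζ : Fin m → H, (∀ j, ζ j ∈ subdiff (batchPot Φi (B j)) x) ∧ η = ∑ j, π j • ζ j}

/-- `ξ` splits the minimal norm subgradient of `Φ` into subgradients of the batch potentials.
Only the values on the domain of the subdifferential of `Φ` matter. -/
def IsDecomposition {H : Type*} [NormedAddCommGroup H] [InnerProductSpace ℝ H] {n m : ℕ}
    (Φ : H → EReal) (Φi : Fin n → H → EReal) (B : Fin m → Finset (Fin n)) (π : Fin m → ℝ)
    (ξ : Fin m → H → H) : Prop :=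
  ∀ x ∈ domSubdiff Φ,
    (∀ j, ξ j x ∈ subdiff (batchPot Φi (B j)) x) ∧ minSubgrad Φ x = ∑ j, π j • ξ j x

/-- The variance `Λ` of the decomposition `ξ`. -/
def variance {H : Type*} [NormedAddCommGroup H] [InnerProductSpace ℝ H] {m : ℕ}
    (Φ : H → EReal) (π : Fin m → ℝ) (ξ : Fin m → H → H) (x : H) : ℝ :=
  ∑ j, π j * ‖ξ j x - minSubgrad Φ x‖ ^ 2

/-- Strong solutions on `[0, ∞)` of the gradient flow of `Φ` (only the values of `u` on `[0, ∞)`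
matter). Absolutely continuous curves in a Hilbert space are differentiable almost everywhere. -/
structure IsGradientFlow {H : Type*} [NormedAddCommGroup H] [InnerProductSpace ℝ H]
    (Φ : H → EReal) (u₀ : H) (u : ℝ → H) : Prop where
  init : u 0 = u₀
  ac : ∀ T, 0 ≤ T → AbsolutelyContinuousOnInterval u 0 T
  inclusion : ∀ᵐ t, 0 < t → ∃ u', HasDerivAt u u' t ∧ -u' ∈ subdiff Φ (u t)

/-- Solutions on `[0, ∞)` of the mini-batch descent flow with waiting time `ε` along a sequence `j`
of batch indices, counted from `0`: on `[k ε, (k + 1) ε)` the flow follows the batch `B (j k)`. -/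
structure IsMiniBatchFlow {H : Type*} [NormedAddCommGroup H] [InnerProductSpace ℝ H] {n m : ℕ}
    (Φi : Fin n → H → EReal) (B : Fin m → Finset (Fin n)) (u₀ : H) (ε : ℝ) (j : ℕ → Fin m)
    (v : ℝ → H) : Prop where
  init : v 0 = u₀
  cont : ContinuousOn v (Ici 0)
  ac : ∀ k : ℕ, ∀ a b : ℝ, k * ε < a → a ≤ b → b < (k + 1) * ε →
    AbsolutelyContinuousOnInterval v a b
  inclusion : ∀ k : ℕ, ∀ᵐ t, t ∈ Ioo (k * ε) ((k + 1) * ε) →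
    ∃ v', HasDerivAt v v' t ∧ -v' ∈ subdiff (batchPot Φi (B (j k))) (v t)

end

end MiniBatch

/-! Compare both flows through `w = v - u`. For a.e. time `u` moves with velocity `-∂Φ(u)°`, and on
each step `v` moves along `-∂Φ_B(v)` for one batch. Insert the subgradient `ξ_j(u)` of the active
batch: monotonicity of `∂Φ_B` discards the difference between `v` and `u`, and Cauchy–Schwarz leaves
`d/dt ‖w‖ ≤ ‖ξ_j(u) - ∂Φ(u)°‖`. Since `Λ` contains this squared norm with weight `π_j`, the right
side is at most `max π^(-1/2) * √Λ(u)`, whichever batch is drawn. No probability enters: integrate,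
chain the steps, and apply Hölder.

The carriers are `norm_le_add_lintegral_of_continuousOn` (integrated comparison),
`IsGradientFlow.ae_hasDerivAt` (minimal selection) and `dist_le_add_lintegral_of_mem_step` (one
step). The bound on `‖v‖` adds `‖u t - u₀‖ ≤ t ‖∂Φ(u₀)°‖`. -/

/-- The norm of an absolutely continuous curve is absolutely continuous. -/
theorem AbsolutelyContinuousOnInterval.norm_comp {H : Type*} [NormedAddCommGroup H] {f : ℝ → H}
    {a b : ℝ} (hf : AbsolutelyContinuousOnInterval f a b) :
    AbsolutelyContinuousOnInterval (fun t => ‖f t‖) a b := by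
  refine squeeze_zero (fun E => Finset.sum_nonneg fun i _ => dist_nonneg) (fun E => ?_) hf
  refine Finset.sum_le_sum fun i _ => ?_
  rw [dist_eq_norm (f _)]
  exact dist_norm_norm_le _ _

/-- Real Lebesgue integrals are dominated by the lower integral of the positive part. -/
theorem MeasureTheory.ofReal_integral_le_lintegral_ofReal {α : Type*} [MeasurableSpace α]
    {μ : Measure α} {g : α → ℝ} (hg : Integrable g μ) :
    ENNReal.ofReal (∫ x, g x ∂μ) ≤ ∫⁻ x, ENNReal.ofReal (g x) ∂μ := by
  calc ENNReal.ofReal (∫ x, g x ∂μ) ≤ ENNReal.ofReal (∫ x, max (g x) 0 ∂μ) :=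
        ENNReal.ofReal_le_ofReal (integral_mono hg hg.pos_part fun x => le_max_left _ _)
    _ = ∫⁻ x, ENNReal.ofReal (max (g x) 0) ∂μ :=
        ofReal_integral_eq_lintegral_ofReal hg.pos_part
          (Filter.Eventually.of_forall fun x => le_max_right _ _)
    _ = _ := by simp

/-- **Hölder's inequality** for the lower integral of a possibly nonmeasurable function. -/
theorem MeasureTheory.lintegral_le_measure_univ_mul_lintegral_sq {α : Type*} [MeasurableSpace α]
    (μ : Measure α) (F : α → ENNReal) :
    ∫⁻ x, F x ∂μ ≤ μ univ ^ (1 / 2 : ℝ) * (∫⁻ x, F x ^ (2 : ℝ) ∂μ) ^ (1 / 2 : ℝ) := by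
  -- A measurable minorant attains the lower integral of `F`; Hölder is applied to it, and `g ≤ F`
  -- returns to `F`.
  obtain ⟨g, hg, hgF, hint⟩ := exists_measurable_le_lintegral_eq (μ := μ) F
  have h := ENNReal.lintegral_mul_le_Lp_mul_Lq μ Real.HolderConjugate.two_two
    (f := fun _ => 1) (g := g) aemeasurable_const hg.aemeasurable
  simp only [Pi.mul_apply, one_mul, ENNReal.one_rpow, lintegral_const] at h
  rw [hint]
  refine h.trans ?_
  gcongr with x
  exact hgF x

/-! ### Differential inequalities for the norm of a curve -/

section Comparison

variable {H : Type*} [NormedAddCommGroup H] [InnerProductSpace ℝ H]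

theorem deriv_norm_le_of_inner_le {f : ℝ → H} {f' : H} {t c : ℝ} (hf : HasDerivAt f f' t)
    (hn : DifferentiableAt ℝ (fun s => ‖f s‖) t) (h : inner ℝ f' (f t) ≤ c * ‖f t‖) (hc : 0 ≤ c) :
    deriv (fun s => ‖f s‖) t ≤ c := by
  rcases eq_or_ne (f t) 0 with h0 | h0
  -- At a zero of `f` the norm is minimal, so its derivative vanishes; elsewhere one divides the
  -- derivative of `‖f‖ ^ 2` by `‖f t‖`.
  · have : IsLocalMin (fun s => ‖f s‖) t :=
      Filter.Eventually.of_forall fun s => by simp [h0]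
    rw [this.deriv_eq_zero]
    exact hc
  · have h1 := hn.hasDerivAt.pow 2
    have h2 := hf.norm_sq
    have h3 := h1.unique h2
    have hpos : 0 < ‖f t‖ := norm_pos_iff.2 h0
    rw [real_inner_comm] at h3
    simp only [Nat.cast_ofNat, Nat.add_one_sub_one, pow_one] at h3
    have : ‖f t‖ * deriv (fun s => ‖f s‖) t ≤ ‖f t‖ * c := by linarith
    exact le_of_mul_le_mul_left this hpos

theorem norm_le_add_lintegral_of_absolutelyContinuous {f : ℝ → H} {G : ℝ → ℝ} {a b : ℝ}
    (hab : a ≤ b) (hG : ∀ t, 0 ≤ G t) (hf : AbsolutelyContinuousOnInterval f a b)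
    (h : ∀ᵐ t, t ∈ Ioo a b → ∃ f', HasDerivAt f f' t ∧ inner ℝ f' (f t) ≤ G t * ‖f t‖) :
    ENNReal.ofReal ‖f b‖ ≤ ENNReal.ofReal ‖f a‖ + ∫⁻ t in Ioo a b, ENNReal.ofReal (G t) := by
  have hw := hf.norm_comp
  have hi : IntegrableOn (deriv fun s => ‖f s‖) (Ioo a b) :=
    ((intervalIntegrable_iff_integrableOn_Ioc_of_le hab).1 hw.intervalIntegrable_deriv).mono_set
      Ioo_subset_Ioc_self
  have hs := hw.integral_deriv_eq_sub
  rw [intervalIntegral.integral_of_le hab, integral_Ioc_eq_integral_Ioo] at hs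
  have : ‖f b‖ = ‖f a‖ + ∫ t in Ioo a b, deriv (fun s => ‖f s‖) t := by linarith
  rw [this]
  refine ENNReal.ofReal_add_le.trans ?_
  gcongr
  refine (ofReal_integral_le_lintegral_ofReal hi).trans (lintegral_mono_ae ?_)
  rw [ae_restrict_iff' measurableSet_Ioo]
  filter_upwards [h, hw.ae_differentiableAt] with t ht hd hmem
  obtain ⟨f', hf', hin⟩ := ht hmem
  refine ENNReal.ofReal_le_ofReal (deriv_norm_le_of_inner_le hf' (hd ?_) hin (hG t))
  rw [uIcc_of_le hab]
  exact Ioo_subset_Icc_self hmem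

/-- A Grönwall type estimate for curves which are absolutely continuous inside an interval. -/
theorem norm_le_add_lintegral_of_continuousOn {f : ℝ → H} {G : ℝ → ℝ} {a b : ℝ}
    (hab : a ≤ b) (hG : ∀ t, 0 ≤ G t) (hc : ContinuousOn f (Icc a b))
    (hf : ∀ c d, a < c → c ≤ d → d < b → AbsolutelyContinuousOnInterval f c d)
    (h : ∀ᵐ t, t ∈ Ioo a b → ∃ f', HasDerivAt f f' t ∧ inner ℝ f' (f t) ≤ G t * ‖f t‖) :
    ENNReal.ofReal ‖f b‖ ≤ ENNReal.ofReal ‖f a‖ + ∫⁻ t in Ioo a b, ENNReal.ofReal (G t) := by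
  rcases hab.eq_or_lt with rfl | hab
  · simp
  have hcn : ContinuousOn (fun t => ENNReal.ofReal ‖f t‖) (Icc a b) :=
    ENNReal.continuous_ofReal.comp_continuousOn hc.norm
  -- Absolute continuity is available only on compact subintervals `[c, d]`; continuity of `f` then
  -- allows `c → a` and `d → b`.
  have key : ∀ d ∈ Ioo a b, ∀ c ∈ Ioo a d, ENNReal.ofReal ‖f d‖ ≤
      ENNReal.ofReal ‖f c‖ + ∫⁻ t in Ioo a b, ENNReal.ofReal (G t) := by
    intro d hd c hcd
    have hsub : Ioo c d ⊆ Ioo a b := Ioo_subset_Ioo hcd.1.le hd.2.le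
    refine (norm_le_add_lintegral_of_absolutelyContinuous hcd.2.le hG
      (hf c d hcd.1 hcd.2.le hd.2) (h.mono fun t ht hm => ht (hsub hm))).trans ?_
    gcongr
  have key2 : ∀ d ∈ Ioo a b, ENNReal.ofReal ‖f d‖ ≤
      ENNReal.ofReal ‖f a‖ + ∫⁻ t in Ioo a b, ENNReal.ofReal (G t) := by
    intro d hd
    refine ContinuousWithinAt.closure_le (s := Ioo a d) (x := a)
      (f := fun _ => ENNReal.ofReal ‖f d‖)
      (g := fun c => ENNReal.ofReal ‖f c‖ + ∫⁻ t in Ioo a b, ENNReal.ofReal (G t))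
      (by rw [closure_Ioo hd.1.ne]; exact left_mem_Icc.2 hd.1.le) continuousWithinAt_const ?_
      (key d hd)
    refine Filter.Tendsto.add ?_ tendsto_const_nhds
    exact (hcn a (left_mem_Icc.2 hab.le)).mono fun x hx => ⟨hx.1.le, hx.2.le.trans hd.2.le⟩
  have hb : b ∈ closure (Ioo a b) := by
    rw [closure_Ioo hab.ne]
    exact right_mem_Icc.2 hab.le
  exact ContinuousWithinAt.closure_le (f := fun d => ENNReal.ofReal ‖f d‖) hb
    ((hcn b (right_mem_Icc.2 hab.le)).mono Ioo_subset_Icc_self)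
    (g := fun _ => ENNReal.ofReal ‖f a‖ + ∫⁻ t in Ioo a b, ENNReal.ofReal (G t))
    continuousWithinAt_const key2

end Comparison

namespace MiniBatch

/-! ### Monotonicity and minimal elements of the subdifferential -/

section Subdifferential

variable {H : Type*} [NormedAddCommGroup H] [InnerProductSpace ℝ H] {Φ : H → EReal}

theorem subdiff_inner_add_le {x y ξ : H} (hbot : ∀ z, Φ z ≠ ⊥) (hξ : ξ ∈ subdiff Φ x)
    (hy : Φ y ≠ ⊤) : (Φ x).toReal + inner ℝ ξ (y - x) ≤ (Φ y).toReal := by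
  have h := hξ.2 y
  rw [← EReal.coe_toReal hξ.1 (hbot x), ← EReal.coe_toReal hy (hbot y)] at h
  exact_mod_cast h

theorem mem_subdiff_iff {x ξ : H} (hbot : ∀ z, Φ z ≠ ⊥) : ξ ∈ subdiff Φ x ↔
    Φ x ≠ ⊤ ∧ ∀ y, Φ y ≠ ⊤ → (Φ x).toReal + inner ℝ ξ (y - x) ≤ (Φ y).toReal := by
  refine ⟨fun h => ⟨h.1, fun y hy => subdiff_inner_add_le hbot h hy⟩, fun h => ⟨h.1, fun y => ?_⟩⟩
  by_cases hy : Φ y = ⊤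
  · simp [hy]
  · rw [← EReal.coe_toReal h.1 (hbot x), ← EReal.coe_toReal hy (hbot y)]
    exact_mod_cast h.2 y hy

theorem subdiff_monotone {x y ξ η : H} (hbot : ∀ z, Φ z ≠ ⊥) (hξ : ξ ∈ subdiff Φ x)
    (hη : η ∈ subdiff Φ y) : 0 ≤ inner ℝ (ξ - η) (x - y) := by
  have h1 := subdiff_inner_add_le hbot hξ hη.1
  have h2 := subdiff_inner_add_le hbot hη hξ.1
  rw [← neg_sub x y, inner_neg_right] at h1
  rw [inner_sub_left]
  linarith

theorem convex_subdiff (hbot : ∀ z, Φ z ≠ ⊥) (x : H) : Convex ℝ (subdiff Φ x) := by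
  intro ξ hξ η hη a b ha hb hab
  rw [mem_subdiff_iff hbot] at *
  refine ⟨hξ.1, fun y hy => ?_⟩
  rw [inner_add_left, inner_smul_left, inner_smul_left]
  have h1 := mul_le_mul_of_nonneg_left (hξ.2 y hy) ha
  have h2 := mul_le_mul_of_nonneg_left (hη.2 y hy) hb
  obtain rfl : b = 1 - a := by linarith
  simp only [conj_trivial]
  linarith

theorem isClosed_subdiff (hbot : ∀ z, Φ z ≠ ⊥) (x : H) : IsClosed (subdiff Φ x) := by
  have : subdiff Φ x = {ξ | Φ x ≠ ⊤} ∩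
      ⋂ y, ⋂ (_ : Φ y ≠ ⊤), {ξ | (Φ x).toReal + inner ℝ ξ (y - x) ≤ (Φ y).toReal} := by
    ext ξ
    simp [mem_subdiff_iff hbot]
  rw [this]
  refine isClosed_const.inter (isClosed_iInter fun y => isClosed_iInter fun _ => ?_)
  exact isClosed_le (by fun_prop) continuous_const

theorem minSubgrad_spec_of_exists {x : H}
    (h : ∃ ξ ∈ subdiff Φ x, ∀ η ∈ subdiff Φ x, ‖ξ‖ ≤ ‖η‖) :
    minSubgrad Φ x ∈ subdiff Φ x ∧ ∀ η ∈ subdiff Φ x, ‖minSubgrad Φ x‖ ≤ ‖η‖ := by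
  rw [minSubgrad, dif_pos h]
  exact h.choose_spec

theorem minSubgrad_spec [CompleteSpace H] {x : H} (hbot : ∀ z, Φ z ≠ ⊥) (hx : x ∈ domSubdiff Φ) :
    minSubgrad Φ x ∈ subdiff Φ x ∧ ∀ η ∈ subdiff Φ x, ‖minSubgrad Φ x‖ ≤ ‖η‖ := by
  obtain ⟨ξ, hξ, hmin⟩ := exists_norm_eq_iInf_of_complete_convex hx
    (isClosed_subdiff hbot x).isComplete (convex_subdiff hbot x) 0
  refine minSubgrad_spec_of_exists ⟨ξ, hξ, fun η hη => ?_⟩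
  simp only [zero_sub, norm_neg] at hmin
  rw [hmin]
  exact ciInf_le (f := fun w : subdiff Φ x => ‖(w : H)‖)
    ⟨0, Set.forall_mem_range.2 fun _ => norm_nonneg _⟩ ⟨η, hη⟩

/-- By convexity the midpoint of two minimizers has norm at least theirs, so the parallelogram law
forces them to coincide. The minimizer `ξ` itself supplies existence, so completeness is not needed.
-/
theorem eq_minSubgrad {x ξ : H} (hbot : ∀ z, Φ z ≠ ⊥) (hξ : ξ ∈ subdiff Φ x)
    (hmin : ∀ η ∈ subdiff Φ x, ‖ξ‖ ≤ ‖η‖) : ξ = minSubgrad Φ x := by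
  obtain ⟨hm, hmm⟩ := minSubgrad_spec_of_exists ⟨ξ, hξ, hmin⟩
  have hn : ‖ξ‖ = ‖minSubgrad Φ x‖ := le_antisymm (hmin _ hm) (hmm _ hξ)
  have hmid := hmin _ (convex_subdiff hbot x hξ hm (by norm_num : (0 : ℝ) ≤ 1 / 2)
    (by norm_num : (0 : ℝ) ≤ 1 / 2) (by norm_num))
  rw [← smul_add, norm_smul] at hmid
  have hpar := parallelogram_law_with_norm ℝ ξ (minSubgrad Φ x)
  rw [← hn] at hpar
  have h2 : 2 * ‖ξ‖ ≤ ‖ξ + minSubgrad Φ x‖ := by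
    norm_num at hmid
    linarith
  have h3 : ‖ξ - minSubgrad Φ x‖ = 0 := by
    nlinarith [norm_nonneg ξ, norm_nonneg (ξ - minSubgrad Φ x)]
  exact sub_eq_zero.1 (norm_eq_zero.1 h3)

end Subdifferential

theorem batchPot_ne_bot {H : Type*} {n : ℕ} {Φi : Fin n → H → EReal} (h : ∀ i x, Φi i x ≠ ⊥)
    (B : Finset (Fin n)) (x : H) : batchPot Φi B x ≠ ⊥ := by
  have hs : ∑ i ∈ B, Φi i x ≠ ⊥ := by
    refine Finset.sum_induction _ (fun z : EReal => z ≠ ⊥) (fun a b ha hb => ?_) (by simp)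
      fun i _ => h i x
    exact EReal.add_ne_bot_iff.2 ⟨ha, hb⟩
  rw [batchPot, EReal.mul_ne_bot]
  have h0 : (0 : EReal) ≤ (((B.card : ℝ)⁻¹ : ℝ) : EReal) := by
    exact_mod_cast (by positivity : (0 : ℝ) ≤ (B.card : ℝ)⁻¹)
  exact ⟨Or.inl (EReal.coe_ne_bot _), Or.inr hs, Or.inl (EReal.coe_ne_top _), Or.inl h0⟩

end MiniBatch

namespace MiniBatch

/-! ### Speed of the gradient flow -/

section GradientFlow

variable {H : Type*} [NormedAddCommGroup H] [InnerProductSpace ℝ H] {Φ : H → EReal}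
  {u₀ : H} {u : ℝ → H}

theorem IsGradientFlow.absolutelyContinuous (hu : IsGradientFlow Φ u₀ u) {a b : ℝ} (ha : 0 ≤ a)
    (hab : a ≤ b) : AbsolutelyContinuousOnInterval u a b :=
  (hu.ac b (ha.trans hab)).mono (by
    rw [uIcc_of_le hab, uIcc_of_le (ha.trans hab)]
    exact Icc_subset_Icc_left ha)

/-- The speed of a gradient flow is dominated by any subgradient at an earlier time. -/
theorem IsGradientFlow.norm_sub_le (hbot : ∀ x, Φ x ≠ ⊥) (hu : IsGradientFlow Φ u₀ u)
    {t s : ℝ} (ht : 0 ≤ t) (hts : t ≤ s) {η : H} (hη : η ∈ subdiff Φ (u t)) :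
    ‖u s - u t‖ ≤ (s - t) * ‖η‖ := by
  have hac : AbsolutelyContinuousOnInterval (fun r => u r - u t) t s := by
    simpa only [AbsolutelyContinuousOnInterval, dist_sub_right] using
      hu.absolutelyContinuous ht hts
  have h := norm_le_add_lintegral_of_absolutelyContinuous (G := fun _ => ‖η‖) hts
    (fun _ => norm_nonneg _) hac (by
      filter_upwards [hu.inclusion] with r hr hmem
      obtain ⟨u', hd, hs⟩ := hr (ht.trans_lt hmem.1)
      refine ⟨u', hd.sub_const _, ?_⟩
      -- Monotonicity between times `r` and `t` gives `⟪u', u r - u t⟫ ≤ -⟪η, u r - u t⟫`.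
      have h1 := subdiff_monotone hbot hs hη
      rw [inner_sub_left, inner_neg_left] at h1
      have h2 := neg_le_of_abs_le (abs_real_inner_le_norm η (u r - u t))
      linarith)
  simp only [sub_self, norm_zero, ENNReal.ofReal_zero, zero_add, lintegral_const,
    MeasurableSet.univ, Measure.restrict_apply, univ_inter, Real.volume_Ioo] at h
  rw [← ENNReal.ofReal_mul (norm_nonneg _), mul_comm] at h
  exact (ENNReal.ofReal_le_ofReal_iff
    (mul_nonneg (sub_nonneg.2 hts) (norm_nonneg _))).1 h

/-- A gradient flow follows the subgradient of minimal norm almost everywhere. -/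
theorem IsGradientFlow.ae_hasDerivAt (hbot : ∀ x, Φ x ≠ ⊥) (hu : IsGradientFlow Φ u₀ u) :
    ∀ᵐ t, 0 < t → u t ∈ domSubdiff Φ ∧ HasDerivAt u (-minSubgrad Φ (u t)) t := by
  filter_upwards [hu.inclusion] with t ht ht0
  obtain ⟨u', hd, hs⟩ := ht ht0
  refine ⟨⟨_, hs⟩, ?_⟩
  rw [← eq_minSubgrad hbot hs, neg_neg]
  · exact hd
  intro η hη
  rw [norm_neg]
  -- The forward difference quotients at `t` have norm at most `‖η‖`, hence so does their limit.
  have hsl := (hasDerivWithinAt_iff_tendsto_slope' (s := Ioi t) self_notMem_Ioi).1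
    hd.hasDerivWithinAt
  refine le_of_tendsto hsl.norm ?_
  filter_upwards [self_mem_nhdsWithin] with s hs
  have hst : 0 < s - t := sub_pos.2 hs
  rw [slope_def_module, norm_smul, norm_inv, Real.norm_of_nonneg hst.le, inv_mul_le_iff₀ hst]
  exact hu.norm_sub_le hbot ht0.le (le_of_lt hs) hη

end GradientFlow

/-! ### Comparison of the mini-batch flow with the gradient flow -/

section Batches

variable {H : Type*} [NormedAddCommGroup H] [InnerProductSpace ℝ H] {n m : ℕ}
  {Φ : H → EReal} {Φi : Fin n → H → EReal} {p : Fin n → ℝ} {B : Fin m → Finset (Fin n)}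
  {π : Fin m → ℝ} {ξ : Fin m → H → H} {u₀ : H} {u v : ℝ → H} {ε : ℝ} {j : ℕ → Fin m}

theorem variance_nonneg (hπ : ∀ l, 0 < π l) (x : H) : 0 ≤ variance Φ π ξ x :=
  Finset.sum_nonneg fun l _ => mul_nonneg (hπ l).le (sq_nonneg _)

theorem norm_sub_minSubgrad_le (hπ : ∀ l, 0 < π l) (l : Fin m) (x : H) :
    ‖ξ l x - minSubgrad Φ x‖ ≤
      (⨆ l, π l ^ (-(1 / 2) : ℝ)) * Real.sqrt (variance Φ π ξ x) := by
  have h1 : π l * ‖ξ l x - minSubgrad Φ x‖ ^ 2 ≤ variance Φ π ξ x :=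
    Finset.single_le_sum (f := fun l => π l * ‖ξ l x - minSubgrad Φ x‖ ^ 2)
      (fun i _ => mul_nonneg (hπ i).le (sq_nonneg _)) (Finset.mem_univ l)
  have h2 := Real.sqrt_le_sqrt h1
  rw [Real.sqrt_mul (hπ l).le, Real.sqrt_sq (norm_nonneg _)] at h2
  have h3 : π l ^ (-(1 / 2) : ℝ) * Real.sqrt (π l) = 1 := by
    rw [Real.sqrt_eq_rpow, ← Real.rpow_add (hπ l)]
    norm_num
  calc ‖ξ l x - minSubgrad Φ x‖
      = π l ^ (-(1 / 2) : ℝ) * (Real.sqrt (π l) * ‖ξ l x - minSubgrad Φ x‖) := by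
        rw [← mul_assoc, h3, one_mul]
    _ ≤ π l ^ (-(1 / 2) : ℝ) * Real.sqrt (variance Φ π ξ x) :=
        mul_le_mul_of_nonneg_left h2 (Real.rpow_nonneg (hπ l).le _)
    _ ≤ _ := mul_le_mul_of_nonneg_right
        (le_ciSup (f := fun l => π l ^ (-(1 / 2) : ℝ)) (finite_range _).bddAbove l)
        (Real.sqrt_nonneg _)

theorem iSup_rpow_nonneg (hπ : ∀ l, 0 < π l) : 0 ≤ ⨆ l, π l ^ (-(1 / 2) : ℝ) :=
  Real.iSup_nonneg fun l => Real.rpow_nonneg (hπ l).le _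

theorem dist_le_add_lintegral_of_mem_step (hΦ : IsSplitting Φ Φi p B π)
    (hξ : IsDecomposition Φ Φi B π ξ) (hu : IsGradientFlow Φ u₀ u) (hε : 0 < ε)
    (hv : IsMiniBatchFlow Φi B u₀ ε j v) (k : ℕ) {b : ℝ} (hb : k * ε ≤ b)
    (hb' : b ≤ (k + 1) * ε) :
    ENNReal.ofReal ‖v b - u b‖ ≤ ENNReal.ofReal ‖v (k * ε) - u (k * ε)‖ +
      ∫⁻ t in Ioo (k * ε) b, ENNReal.ofReal
        ((⨆ l, π l ^ (-(1 / 2) : ℝ)) * Real.sqrt (variance Φ π ξ (u t))) := by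
  have hk : 0 ≤ k * ε := by positivity
  have hbot := hΦ.potential.ne_bot
  have hbotB := batchPot_ne_bot (fun i x => (hΦ.potential_i i).ne_bot x) (B (j k))
  refine norm_le_add_lintegral_of_continuousOn (f := fun t => v t - u t) hb
    (fun t => mul_nonneg (iSup_rpow_nonneg hΦ.π_pos) (Real.sqrt_nonneg _)) ?_ ?_ ?_
  · refine (hv.cont.mono fun x hx => hk.trans hx.1).sub ?_
    rw [← uIcc_of_le hb]
    exact (hu.absolutelyContinuous hk hb).continuousOn
  · intro c d hc hcd hd
    exact (hv.ac k c d hc hcd (hd.trans_le hb')).sub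
      (hu.absolutelyContinuous (hk.trans hc.le) hcd)
  · filter_upwards [hv.inclusion k, hu.ae_hasDerivAt hbot] with t htv htu hmem
    obtain ⟨v', hdv, hsv⟩ := htv ⟨hmem.1, hmem.2.trans_le hb'⟩
    obtain ⟨hdom, hdu⟩ := htu (hk.trans_lt hmem.1)
    refine ⟨_, hdv.sub hdu, ?_⟩
    have hmono := subdiff_monotone hbotB hsv ((hξ _ hdom).1 (j k))
    -- Insert `ξ (j k) (u t)`: the first term is nonpositive by monotonicity, the second is
    -- controlled by the variance.
    have hsplit : inner ℝ (v' - -minSubgrad Φ (u t)) (v t - u t) =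
        -inner ℝ (-v' - ξ (j k) (u t)) (v t - u t) -
          inner ℝ (ξ (j k) (u t) - minSubgrad Φ (u t)) (v t - u t) := by
      rw [← inner_neg_left, ← inner_sub_left]
      congr 1
      abel
    have hcs := neg_le_of_abs_le
      (abs_real_inner_le_norm (ξ (j k) (u t) - minSubgrad Φ (u t)) (v t - u t))
    have hb := mul_le_mul_of_nonneg_right
      (norm_sub_minSubgrad_le (Φ := Φ) (ξ := ξ) hΦ.π_pos (j k) (u t)) (norm_nonneg (v t - u t))
    rw [hsplit]
    linarith

theorem dist_le_lintegral_sqrt_variance (hΦ : IsSplitting Φ Φi p B π)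
    (hξ : IsDecomposition Φ Φi B π ξ) (hu : IsGradientFlow Φ u₀ u) (hε : 0 < ε)
    (hv : IsMiniBatchFlow Φi B u₀ ε j v) {t : ℝ} (ht : 0 ≤ t) :
    ENNReal.ofReal ‖v t - u t‖ ≤ ∫⁻ s in Icc 0 t, ENNReal.ofReal
      ((⨆ l, π l ^ (-(1 / 2) : ℝ)) * Real.sqrt (variance Φ π ξ (u s))) := by
  -- The closed upper bound on `b` includes the switching time, where the next step starts.
  have key : ∀ k : ℕ, ∀ b : ℝ, k * ε ≤ b → b ≤ (k + 1) * ε →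
      ENNReal.ofReal ‖v b - u b‖ ≤ ∫⁻ s in Ico 0 b, ENNReal.ofReal
        ((⨆ l, π l ^ (-(1 / 2) : ℝ)) * Real.sqrt (variance Φ π ξ (u s))) := by
    intro k
    induction k with
    | zero =>
      intro b hb hb'
      have h := dist_le_add_lintegral_of_mem_step hΦ hξ hu hε hv 0 hb hb'
      simp only [Nat.cast_zero, zero_mul, hv.init, hu.init, sub_self, norm_zero,
        ENNReal.ofReal_zero, zero_add] at h
      exact h.trans (lintegral_mono_set Ioo_subset_Ico_self)
    | succ k ih =>
      intro b hb hb'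
      have h0 : (0 : ℝ) ≤ ((k + 1 : ℕ) : ℝ) * ε := by positivity
      refine (dist_le_add_lintegral_of_mem_step hΦ hξ hu hε hv (k + 1) hb hb').trans ?_
      -- Half-open intervals tile exactly, and additivity over measurable sets does not require a
      -- measurable integrand.
      rw [← Ico_union_Ico_eq_Ico h0 hb,
        lintegral_union measurableSet_Ico (Ico_disjoint_Ico_same)]
      refine add_le_add (ih _ ?_ ?_) (lintegral_mono_set Ioo_subset_Ico_self)
      · push_cast
        nlinarith
      · push_cast
        exact le_rfl
  have hfl := Nat.floor_le (div_nonneg ht hε.le)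
  have hfl' := Nat.lt_floor_add_one (t / ε)
  refine (key ⌊t / ε⌋₊ t ((le_div_iff₀ hε).1 hfl) ((div_lt_iff₀ hε).1 hfl').le).trans ?_
  exact lintegral_mono_set Ico_subset_Icc_self

theorem dist_le_lintegral_variance (hΦ : IsSplitting Φ Φi p B π)
    (hξ : IsDecomposition Φ Φi B π ξ) (hu : IsGradientFlow Φ u₀ u) (hε : 0 < ε)
    (hv : IsMiniBatchFlow Φi B u₀ ε j v) {t : ℝ} (ht : 0 ≤ t) :
    ENNReal.ofReal ‖v t - u t‖ ≤
      ENNReal.ofReal (⨆ l, π l ^ (-(1 / 2) : ℝ)) * ENNReal.ofReal t ^ (1 / 2 : ℝ) *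
        (∫⁻ s in Icc 0 t, ENNReal.ofReal (variance Φ π ξ (u s))) ^ (1 / 2 : ℝ) := by
  refine (dist_le_lintegral_sqrt_variance hΦ hξ hu hε hv ht).trans ?_
  simp_rw [ENNReal.ofReal_mul (iSup_rpow_nonneg hΦ.π_pos)]
  rw [lintegral_const_mul' _ _ ENNReal.ofReal_ne_top, mul_assoc]
  gcongr
  refine (lintegral_le_measure_univ_mul_lintegral_sq _ _).trans_eq ?_
  simp only [MeasurableSet.univ, Measure.restrict_apply, univ_inter, Real.volume_Icc, sub_zero]
  congr 3 with s
  rw [ENNReal.ofReal_rpow_of_nonneg (Real.sqrt_nonneg _) zero_le_two, Real.rpow_two,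
    Real.sq_sqrt (variance_nonneg hΦ.π_pos _)]

theorem norm_le_lintegral_variance [CompleteSpace H] (hΦ : IsSplitting Φ Φi p B π)
    (hξ : IsDecomposition Φ Φi B π ξ) (hu₀ : u₀ ∈ domSubdiff Φ) (hu : IsGradientFlow Φ u₀ u)
    (hε : 0 < ε) (hv : IsMiniBatchFlow Φi B u₀ ε j v) {t : ℝ} (ht : 0 ≤ t) :
    ENNReal.ofReal ‖v t‖ ≤
      ENNReal.ofReal (⨆ l, π l ^ (-(1 / 2) : ℝ)) * ENNReal.ofReal t ^ (1 / 2 : ℝ) *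
        (∫⁻ s in Icc 0 t, ENNReal.ofReal (variance Φ π ξ (u s))) ^ (1 / 2 : ℝ) +
      ENNReal.ofReal (t * ‖minSubgrad Φ u₀‖) + ENNReal.ofReal ‖u₀‖ := by
  have hbot := hΦ.potential.ne_bot
  have h1 := hu.norm_sub_le hbot le_rfl ht
    (by rw [hu.init]; exact (minSubgrad_spec hbot hu₀).1)
  rw [hu.init, sub_zero] at h1
  calc ENNReal.ofReal ‖v t‖
      ≤ ENNReal.ofReal (‖v t - u t‖ + ‖u t - u₀‖ + ‖u₀‖) := by
        refine ENNReal.ofReal_le_ofReal ?_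
        have := norm_add₃_le (a := v t - u t) (b := u t - u₀) (c := u₀)
        simpa using this
    _ = ENNReal.ofReal ‖v t - u t‖ + ENNReal.ofReal ‖u t - u₀‖ + ENNReal.ofReal ‖u₀‖ := by
        rw [ENNReal.ofReal_add (by positivity) (norm_nonneg _),
          ENNReal.ofReal_add (norm_nonneg _) (norm_nonneg _)]
    _ ≤ _ := by
        gcongr
        exact dist_le_lintegral_variance hΦ hξ hu hε hv ht

theorem exists_uniform_bound [CompleteSpace H] (hΦ : IsSplitting Φ Φi p B π)
    (hξ : IsDecomposition Φ Φi B π ξ) (hu₀ : u₀ ∈ domSubdiff Φ) (hu : IsGradientFlow Φ u₀ u)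
    (hint : LocallyIntegrableOn (fun s => variance Φ π ξ (u s)) (Ici 0) volume)
    (T : ℝ) :
    ∃ C : ℝ, 0 ≤ C ∧ ∀ ε : ℝ, 0 < ε → ∀ (j : ℕ → Fin m) (v : ℝ → H),
      IsMiniBatchFlow Φi B u₀ ε j v → ∀ t ∈ Icc 0 T, ‖v t‖ ≤ C := by
  -- The previous bound is monotone in `t`, so its value at `T` serves all of `[0, T]`.
  set R : ENNReal :=
    ENNReal.ofReal (⨆ l, π l ^ (-(1 / 2) : ℝ)) * ENNReal.ofReal T ^ (1 / 2 : ℝ) *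
        (∫⁻ s in Icc 0 T, ENNReal.ofReal (variance Φ π ξ (u s))) ^ (1 / 2 : ℝ) +
      ENNReal.ofReal (T * ‖minSubgrad Φ u₀‖) + ENNReal.ofReal ‖u₀‖ with hR
  have hfin : ∫⁻ s in Icc 0 T, ENNReal.ofReal (variance Φ π ξ (u s)) ≠ ⊤ :=
    (hint.integrableOn_compact_subset Icc_subset_Ici_self isCompact_Icc).lintegral_lt_top.ne
  have hRtop : R ≠ ⊤ := by
    have h2 : (0 : ℝ) ≤ 1 / 2 := by norm_num
    refine ENNReal.add_ne_top.2 ⟨ENNReal.add_ne_top.2 ⟨ENNReal.mul_ne_top (ENNReal.mul_ne_top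
      ENNReal.ofReal_ne_top ?_) ?_, ENNReal.ofReal_ne_top⟩, ENNReal.ofReal_ne_top⟩
    · exact ENNReal.rpow_ne_top_of_nonneg h2 ENNReal.ofReal_ne_top
    · exact ENNReal.rpow_ne_top_of_nonneg h2 hfin
  refine ⟨R.toReal, ENNReal.toReal_nonneg, fun ε hε j v hv t ht => ?_⟩
  rw [← ENNReal.ofReal_le_iff_le_toReal hRtop]
  refine (norm_le_lintegral_variance hΦ hξ hu₀ hu hε hv ht.1).trans ?_
  rw [hR]
  gcongr
  exacts [ht.2, ht.2, ht.2]

theorem IsMiniBatchFlow.memLp_two_of_norm_le (hv : IsMiniBatchFlow Φi B u₀ ε j v) {T C : ℝ}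
    (hT : 0 ≤ T) (hC : 0 ≤ C) (hbound : ∀ t ∈ Icc 0 T, ‖v t‖ ≤ C) :
    MemLp v 2 (volume.restrict (Icc 0 T)) ∧
      eLpNorm v 2 (volume.restrict (Icc 0 T)) ≤ ENNReal.ofReal (C * Real.sqrt T) := by
  have hae : ∀ᵐ t ∂volume.restrict (Icc 0 T), ‖v t‖ ≤ C :=
    (ae_restrict_iff' measurableSet_Icc).2 (Filter.Eventually.of_forall hbound)
  refine ⟨MemLp.of_bound ((hv.cont.mono Icc_subset_Ici_self).aestronglyMeasurable
    measurableSet_Icc) C hae, (eLpNorm_le_of_ae_bound hae).trans_eq ?_⟩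
  simp only [MeasurableSet.univ, Measure.restrict_apply, univ_inter, Real.volume_Icc, sub_zero,
    ENNReal.toReal_ofNat]
  rw [ENNReal.ofReal_mul hC, mul_comm, ENNReal.ofReal_rpow_of_nonneg hT (by norm_num),
    Real.sqrt_eq_rpow, one_div]

end Batches

end MiniBatch

theorem proposition2p2
    {H : Type*} [NormedAddCommGroup H] [InnerProductSpace ℝ H] [CompleteSpace H]
    {n m : ℕ} (Φ : H → EReal) (Φi : Fin n → H → EReal) (p : Fin n → ℝ)
    (B : Fin m → Finset (Fin n)) (π : Fin m → ℝ)
    (hΦ : MiniBatch.IsSplitting Φ Φi p B π)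
    (ξ : Fin m → H → H) (hξ : MiniBatch.IsDecomposition Φ Φi B π ξ)
    {Ω : Type*} [MeasurableSpace Ω] (P : Measure Ω) [IsProbabilityMeasure P]
    (j : ℕ → Ω → Fin m) (hj_meas : ∀ k, Measurable (j k))
    (hj_indep : ProbabilityTheory.iIndepFun j P)
    (hj_law : ∀ k l, P {ω | j k ω = l} = ENNReal.ofReal (π l))
    (u₀ : H) (hu₀ : u₀ ∈ MiniBatch.domSubdiff Φ)
    (u : ℝ → H) (hu : MiniBatch.IsGradientFlow Φ u₀ u) :
    -- the distance to the gradient flow, for every realization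
    (∀ ε : ℝ, 0 < ε → ∀ ω : Ω, ∀ v : ℝ → H,
      MiniBatch.IsMiniBatchFlow Φi B u₀ ε (fun k => j k ω) v → ∀ t : ℝ, 0 ≤ t →
        ENNReal.ofReal ‖v t - u t‖ ≤
          ENNReal.ofReal (⨆ l, π l ^ (-(1 / 2) : ℝ)) * ENNReal.ofReal t ^ (1 / 2 : ℝ) *
            (∫⁻ s in Icc 0 t, ENNReal.ofReal (MiniBatch.variance Φ π ξ (u s))) ^ (1 / 2 : ℝ)) ∧
    -- the size of the mini-batch flow, for every realization
    (∀ ε : ℝ, 0 < ε → ∀ ω : Ω, ∀ v : ℝ → H,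
      MiniBatch.IsMiniBatchFlow Φi B u₀ ε (fun k => j k ω) v → ∀ t : ℝ, 0 ≤ t →
        ENNReal.ofReal ‖v t‖ ≤
          ENNReal.ofReal (⨆ l, π l ^ (-(1 / 2) : ℝ)) * ENNReal.ofReal t ^ (1 / 2 : ℝ) *
            (∫⁻ s in Icc 0 t, ENNReal.ofReal (MiniBatch.variance Φ π ξ (u s))) ^ (1 / 2 : ℝ) +
          ENNReal.ofReal (t * ‖MiniBatch.minSubgrad Φ u₀‖) + ENNReal.ofReal ‖u₀‖) ∧
    -- local boundedness, uniformly in the waiting time and in the realization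
    (LocallyIntegrableOn (fun s => MiniBatch.variance Φ π ξ (u s)) (Ici 0) volume →
      ∀ T : ℝ, 0 ≤ T → ∃ C : ℝ, ∀ ε : ℝ, 0 < ε → ∀ ω : Ω, ∀ v : ℝ → H,
        MiniBatch.IsMiniBatchFlow Φi B u₀ ε (fun k => j k ω) v →
          (∀ t ∈ Icc 0 T, ‖v t‖ ≤ C) ∧
          MemLp v 2 (volume.restrict (Icc 0 T)) ∧
          eLpNorm v 2 (volume.restrict (Icc 0 T)) ≤ ENNReal.ofReal C) := by
  refine ⟨fun ε hε ω v hv t ht => MiniBatch.dist_le_lintegral_variance hΦ hξ hu hε hv ht,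
    fun ε hε ω v hv t ht => MiniBatch.norm_le_lintegral_variance hΦ hξ hu₀ hu hε hv ht,
    fun hint T hT => ?_⟩
  obtain ⟨R, hR, hbound⟩ := MiniBatch.exists_uniform_bound hΦ hξ hu₀ hu hint T
  -- One constant for both the pointwise bound `R` and the `L²` bound `R * √T`.
  refine ⟨max R (R * Real.sqrt T), fun ε hε ω v hv => ?_⟩
  have hvR := hbound ε hε _ v hv
  obtain ⟨hmem, hnorm⟩ := hv.memLp_two_of_norm_le hT hR hvR
  exact ⟨fun t ht => (hvR t ht).trans (le_max_left _ _), hmem,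
    hnorm.trans (ENNReal.ofReal_le_ofReal (le_max_right _ _))⟩
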